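/- Let $n \ge 1$ and let $M$ be the Chinese monoid of rank $n$, i.e. the monoid with generators $a_1,\dots,a_n$ and defining relations $a_j a_i a_k = a_j a_k a_i = a_k a_j a_i$ for all $1 \le i \le k \le j \le n$. Let $B = \langle p, q : qp = 1\rangle$ be the bicyclic monoid, let $\mathbb{N}$ be the additive monoid of non-negative integers and $\mathbb{Z}$ the additive group of integers, and let $(T_m)_{m\ge 0}$ be the Tribonacci sequence given by $T_0 = T_1 = T_2 = 1$ and $T_{m+1} = T_m + T_{m-1} + T_{m-2}$ for $m \ge 2$. Then there exist non-negative integers $c, d$ with $c + 2d = nT_n$ and an injective monoid homomorphism $M \hookrightarrow \mathbb{N}^c \times (B \times \mathbb{Z})^d$. -/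

import Mathlib

/-- The defining relations `a_j a_i a_k = a_j a_k a_i = a_k a_j a_i` for `i ≤ k ≤ j`, on the free
monoid with generators `a_i`, `i : Fin n`. -/
inductive ChineseRel (n : ℕ) : FreeMonoid (Fin n) → FreeMonoid (Fin n) → Prop
  | jik_jki (i k j : Fin n) (hik : i ≤ k) (hkj : k ≤ j) :
      ChineseRel n (FreeMonoid.of j * FreeMonoid.of i * FreeMonoid.of k)
        (FreeMonoid.of j * FreeMonoid.of k * FreeMonoid.of i)
  | jki_kji (i k j : Fin n) (hik : i ≤ k) (hkj : k ≤ j) :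
      ChineseRel n (FreeMonoid.of j * FreeMonoid.of k * FreeMonoid.of i)
        (FreeMonoid.of k * FreeMonoid.of j * FreeMonoid.of i)

/-- The Chinese monoid of rank `n`. -/
abbrev ChineseMonoid (n : ℕ) : Type := PresentedMonoid (ChineseRel n)

/-- The two generators of the bicyclic monoid. -/
inductive BicyclicGen : Type
  | p
  | q

/-- The single defining relation `q p = 1` of the bicyclic monoid. -/
inductive BicyclicRel : FreeMonoid BicyclicGen → FreeMonoid BicyclicGen → Prop
  | qp_one : BicyclicRel (FreeMonoid.of BicyclicGen.q * FreeMonoid.of BicyclicGen.p) 1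

/-- The bicyclic monoid `B = ⟨p, q : q p = 1⟩`. -/
abbrev BicyclicMonoid : Type := PresentedMonoid BicyclicRel

/-- The Tribonacci sequence with `T 0 = T 1 = T 2 = 1`. -/
def tribonacci : ℕ → ℕ
  | 0 => 1
  | 1 => 1
  | 2 => 1
  | n + 3 => tribonacci (n + 2) + tribonacci (n + 1) + tribonacci n

/-! Every element of the Chinese monoid is a staircase word, a product of rows in which row `j`
consists of powers of the pairs `a j * a i` with `i < j` followed by a power of `a j`
(`exists_eq_staircase`). To separate these words, let letters below `s` act on `ℕ` as successor,
letters from `t` on as truncated predecessor, and the rest trivially. Applied to `0`, a staircase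
yields the number of letters below `s` in the rows below `t` (`staircase_letterMap_apply_zero`), and
these numbers determine all multiplicities (`eq_of_sum_rowCount_eq`). The action factors through the
bicyclic monoid, and through a letter count when `t = n`. So `n * (n - 1) / 2` bicyclic and `n`
commutative coordinates suffice. They fit the prescribed total when `n ≤ tribonacci n`, which fails
only for `n = 2`; there one count is redundant and the other goes into the `ℤ` factor. -/

section Staircase

/-! ### Staircase words in a monoid -/

variable {M : Type*} [Monoid M]

/-- The Chinese relations for the first `n` terms of a sequence in a monoid. -/
def IsChinese (n : ℕ) (a : ℕ → M) : Prop :=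
  ∀ i k j, i ≤ k → k ≤ j → j < n →
    a j * a i * a k = a j * a k * a i ∧ a j * a k * a i = a k * a j * a i

/-- The product of the powers `(a j * a i) ^ k i` for `i < m`. -/
def pairProd (a : ℕ → M) (j : ℕ) (k : ℕ → ℕ) : ℕ → M
  | 0 => 1
  | m + 1 => pairProd a j k m * (a j * a m) ^ k m

/-- The staircase word with rows `0, …, N - 1` and multiplicities `k`. -/
def staircase (a : ℕ → M) (k : ℕ → ℕ → ℕ) : ℕ → M
  | 0 => 1
  | N + 1 => staircase a k N * (pairProd a N (k N) N * a N ^ k N N)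

theorem pairProd_congr (a : ℕ → M) (j : ℕ) {k k' : ℕ → ℕ} {m : ℕ} (h : ∀ i < m, k i = k' i) :
    pairProd a j k m = pairProd a j k' m := by
  induction m with
  | zero => rfl
  | succ m ih =>
    simp only [pairProd]
    rw [ih fun i hi => h i (by omega), h m (by omega)]

theorem staircase_congr (a : ℕ → M) {k k' : ℕ → ℕ → ℕ} {N : ℕ}
    (h : ∀ j < N, ∀ i ≤ j, k j i = k' j i) : staircase a k N = staircase a k' N := by
  induction N with
  | zero => rfl
  | succ N ih =>
    simp only [staircase]
    rw [ih fun j hj => h j (by omega), h N (by omega) N le_rfl,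
      pairProd_congr a N fun i hi => h N (by omega) i (by omega)]

theorem exists_pairProd_eq (a : ℕ → M) (j : ℕ) (k : ℕ → ℕ) {m m' : ℕ} (h : m ≤ m') :
    ∃ k', pairProd a j k m = pairProd a j k' m' := by
  refine ⟨fun i => if i < m then k i else 0, ?_⟩
  induction m', h using Nat.le_induction with
  | base => exact pairProd_congr a j fun i hi => by simp [hi]
  | succ m' hm ih =>
    rw [ih]
    simp [pairProd, hm]

/-! ### Right multiplication of staircases by a letter -/

namespace IsChinese

variable {n : ℕ} {a : ℕ → M}

theorem commute_pair (ha : IsChinese n a) {i k j : ℕ} (hik : i ≤ k) (hkj : k ≤ j) (hj : j < n) :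
    Commute (a j * a i) (a k) := by
  have h := ha i k j hik hkj hj
  unfold Commute SemiconjBy
  rw [h.1, h.2, mul_assoc]

theorem commute_pair_pair (ha : IsChinese n a) {i k j : ℕ} (hi : i ≤ j) (hk : k ≤ j)
    (hj : j < n) : Commute (a j * a i) (a j * a k) := by
  rcases le_total i k with h | h
  · exact (ha.commute_pair hi le_rfl hj).mul_right (ha.commute_pair h hk hj)
  · exact ((ha.commute_pair hk le_rfl hj).mul_right (ha.commute_pair h hi hj)).symm

theorem commute_pairProd (ha : IsChinese n a) {j l : ℕ} (k : ℕ → ℕ) {m : ℕ} (hm : m ≤ l + 1)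
    (hl : l ≤ j) (hj : j < n) : Commute (pairProd a j k m) (a l) := by
  induction m with
  | zero => exact Commute.one_left _
  | succ m ih =>
    exact (ih (by omega)).mul_left ((ha.commute_pair (by omega) hl hj).pow_left _)

theorem exists_pairProd_mul_pair (ha : IsChinese n a) {j l m : ℕ} (k : ℕ → ℕ) (hl : l < m)
    (hm : m ≤ j) (hj : j < n) :
    ∃ k', pairProd a j k m * (a j * a l) = pairProd a j k' m := by
  refine ⟨Function.update k l (k l + 1), ?_⟩
  induction m, hl using Nat.le_induction with
  | base =>
    simp only [pairProd]
    rw [pairProd_congr a j (k := Function.update k l (k l + 1)) (k' := k)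
      fun i hi => Function.update_of_ne (by omega) _ _]
    simp [pow_succ, mul_assoc]
  | succ m hm' ih =>
    simp only [pairProd]
    rw [← ih (by omega), Function.update_of_ne (by omega), mul_assoc, mul_assoc,
      ((ha.commute_pair_pair (by omega) (by omega) hj).pow_right (k m)).eq]

theorem exists_pairProd_mul (ha : IsChinese n a) {j l m : ℕ} (k : ℕ → ℕ) (hl : l < j)
    (hm : m ≤ j) (hj : j < n) :
    ∃ l' < j, ∃ k', pairProd a j k m * a l = a l' * pairProd a j k' j := by
  induction m with
  | zero =>
    obtain ⟨k', hk'⟩ := exists_pairProd_eq a j k (Nat.zero_le j)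
    exact ⟨l, hl, k', by rw [← hk']; simp [pairProd]⟩
  | succ m ih =>
    rcases le_or_gt m l with h | h
    · obtain ⟨k', hk'⟩ := exists_pairProd_eq a j k hm
      exact ⟨l, hl, k', by rw [← hk', (ha.commute_pairProd k (by omega) hl.le hj).eq]⟩
    · rcases he : k m with _ | e
      · simpa [pairProd, he] using ih (by omega)
      -- One pair `a j * a m` exchanges its `a m` for `a l`. The freed `a m` commutes with every
      -- pair of index at most `m`, so it leaves on the left.
      · obtain ⟨k₁, hk₁⟩ := ha.exists_pairProd_mul_pair k h (by omega) hj
        obtain ⟨k₂, hk₂⟩ : ∃ k₂, pairProd a j k₁ m * (a j * a m) ^ e = pairProd a j k₂ (m + 1) := by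
          refine ⟨Function.update k₁ m e, ?_⟩
          simp only [pairProd]
          rw [pairProd_congr a j (k := Function.update k₁ m e) (k' := k₁)
            fun i hi => Function.update_of_ne (by omega) _ _]
          simp
        obtain ⟨k₃, hk₃⟩ := exists_pairProd_eq a j k₂ hm
        refine ⟨m, by omega, k₃, ?_⟩
        rw [← hk₃, ← (ha.commute_pairProd k₂ le_rfl (by omega) hj).eq, ← hk₂, ← hk₁]
        have hswap : a j * a m * a l = a j * a l * a m :=
          (ha l m j h.le (by omega) hj).1.symm
        have hcomm := (ha.commute_pair_pair (i := m) (k := l) (by omega) (by omega) hj).pow_left e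
        simp only [pairProd, he, pow_succ]
        rw [mul_assoc, mul_assoc ((a j * a m) ^ e), hswap, ← mul_assoc ((a j * a m) ^ e), hcomm.eq]
        simp only [mul_assoc]

theorem exists_staircase_mul (ha : IsChinese n a) {N l : ℕ} (k : ℕ → ℕ → ℕ) (hl : l < N)
    (hN : N ≤ n) : ∃ k', staircase a k N * a l = staircase a k' N := by
  have extend (k₀ : ℕ → ℕ → ℕ) (r : ℕ → ℕ) (e N : ℕ) : ∃ k',
      staircase a k₀ N * (pairProd a N r N * a N ^ e) = staircase a k' (N + 1) := by
    refine ⟨Function.update k₀ N (Function.update r N e), ?_⟩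
    simp only [staircase]
    rw [staircase_congr a (k := Function.update k₀ N _) (k' := k₀) fun j hj i _ => by rw [Function.update_of_ne (by omega)],
      Function.update_self, pairProd_congr a N (k := Function.update r N e) (k' := r)
        fun i hi => Function.update_of_ne (by omega) _ _, Function.update_self]
  induction N generalizing l k with
  | zero => omega
  | succ N ih =>
    rcases Nat.lt_succ_iff_lt_or_eq.mp hl with h | rfl
    -- If the row ends in `a N`, that letter and `a l` form a new pair. Otherwise a letter of index
    -- below `N` leaves the row on the left and is absorbed by the earlier rows.
    · rcases he : k N N with _ | e
      · obtain ⟨l', hl', r, hr⟩ := ha.exists_pairProd_mul (k N) h le_rfl hN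
        obtain ⟨k₁, hk₁⟩ := ih k hl' (by omega)
        obtain ⟨k', hk'⟩ := extend k₁ r 0 N
        refine ⟨k', ?_⟩
        rw [← hk', staircase, he, pow_zero, mul_one, mul_one, mul_assoc, hr, ← mul_assoc, hk₁]
      · obtain ⟨r, hr⟩ := ha.exists_pairProd_mul_pair (k N) h le_rfl hN
        obtain ⟨k', hk'⟩ := extend k r e N
        refine ⟨k', ?_⟩
        have hc := (ha.commute_pair h.le le_rfl hN).pow_right e
        rw [← hk', staircase, he, ← hr, pow_succ]
        simp only [mul_assoc] at hc ⊢
        rw [← mul_assoc (a N) (a l), hc.eq]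
    · obtain ⟨k', hk'⟩ := extend k (k l) (k l l + 1) l
      exact ⟨k', by rw [← hk', staircase, pow_succ]; simp only [mul_assoc]⟩

end IsChinese

end Staircase

/-! ### Recovering multiplicities from the action on `ℕ` -/

section Height

/-- The number of letters with index below `s` in row `j` of a staircase with multiplicities `k`. -/
def rowCount (s : ℕ) (k : ℕ → ℕ → ℕ) (j : ℕ) : ℕ :=
  ∑ i ∈ Finset.range j, k j i * ((if j < s then 1 else 0) + if i < s then 1 else 0) +
    k j j * if j < s then 1 else 0

/-- Differencing in `t` isolates row `j`; for `s ≤ j` its count is a prefix sum of the row, so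
differencing in `s` isolates each off-diagonal entry. -/
theorem eq_of_sum_rowCount_eq {n : ℕ} {k k' : ℕ → ℕ → ℕ}
    (h : ∀ s t, 1 ≤ s → s ≤ t → t ≤ n →
      ∑ j ∈ Finset.range t, rowCount s k j = ∑ j ∈ Finset.range t, rowCount s k' j) :
    ∀ j < n, ∀ i ≤ j, k j i = k' j i := by
  intro j
  induction j using Nat.strong_induction_on with
  | _ j ih =>
  intro hj
  have hprefix (s : ℕ) (hs : s ≤ j) :
      ∑ i ∈ Finset.range s, k j i = ∑ i ∈ Finset.range s, k' j i := by
    rcases Nat.eq_zero_or_pos s with rfl | hs0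
    · simp
    have h1 := h s j hs0 hs hj.le
    have h2 := h s (j + 1) hs0 (by omega) hj
    rw [Finset.sum_range_succ, Finset.sum_range_succ, h1, Nat.add_left_cancel_iff] at h2
    have key (κ : ℕ → ℕ → ℕ) : rowCount s κ j = ∑ i ∈ Finset.range s, κ j i := by
      have hjs : ¬ j < s := by omega
      simp only [rowCount, hjs, if_false, mul_zero, add_zero, zero_add, mul_ite, mul_one]
      rw [← Finset.sum_filter]
      congr 1
      ext i
      simp only [Finset.mem_filter, Finset.mem_range]
      omega
    rwa [key, key] at h2
  have hlt : ∀ i < j, k j i = k' j i := by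
    intro i hi
    have h1 := hprefix i hi.le
    have h2 := hprefix (i + 1) hi
    rw [Finset.sum_range_succ, Finset.sum_range_succ] at h2
    omega
  intro i hi
  rcases hi.lt_or_eq with hi | rfl
  · exact hlt i hi
  -- The diagonal entry needs `s = i + 1`, for which `t = i` is not available; the earlier rows
  -- cancel by induction instead.
  have h2 := h (i + 1) (i + 1) (by omega) le_rfl hj
  have h1 : ∑ j ∈ Finset.range i, rowCount (i + 1) k j =
      ∑ j ∈ Finset.range i, rowCount (i + 1) k' j := by
    refine Finset.sum_congr rfl fun j hji => ?_
    rw [Finset.mem_range] at hji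
    have hrow := ih j hji (by omega)
    unfold rowCount
    rw [hrow j le_rfl, Finset.sum_congr rfl fun l hl => by
      rw [hrow l (Finset.mem_range.mp hl).le]]
  rw [Finset.sum_range_succ, Finset.sum_range_succ, h1, Nat.add_left_cancel_iff] at h2
  unfold rowCount at h2
  rw [Finset.sum_congr rfl fun l hl => by rw [hlt l (Finset.mem_range.mp hl)]] at h2
  simpa using h2

/-- The map sending the letters below `s` to `p`, those from `t` on to `q`, the others to `1`. -/
def letterMap {M : Type*} [Monoid M] (p q : M) (s t i : ℕ) : M :=
  if i < s then p else if i < t then 1 else q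

theorem map_letterMap {M N : Type*} [Monoid M] [Monoid N] (f : M →* N) (p q : M) (s t i : ℕ) :
    f (letterMap p q s t i) = letterMap (f p) (f q) s t i := by
  unfold letterMap
  split_ifs <;> simp

theorem isChinese_letterMap {M : Type*} [Monoid M] {p q : M} (h : q * p = 1) {s t : ℕ}
    (_hst : s ≤ t) (n : ℕ) : IsChinese n (letterMap p q s t) := by
  intro i k j hik hkj _
  unfold letterMap
  split_ifs <;> first | omega | simp [mul_assoc, h]

/-- The successor map in the monoid of self-maps of `ℕ`. -/
def succEnd : Function.End ℕ := Nat.succ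

/-- The predecessor map in the monoid of self-maps of `ℕ`. -/
def predEnd : Function.End ℕ := Nat.pred

theorem predEnd_mul_succEnd : predEnd * succEnd = 1 := rfl

variable {s t : ℕ}

theorem letterMap_apply_of_lt {i : ℕ} (hi : i < t) (v : ℕ) :
    letterMap succEnd predEnd s t i v = v + if i < s then 1 else 0 := by
  unfold letterMap
  split_ifs <;> rfl

theorem letterMap_apply_of_le (hst : s ≤ t) {i : ℕ} (hi : t ≤ i) (v : ℕ) :
    letterMap succEnd predEnd s t i v = v - 1 := by
  unfold letterMap
  rw [if_neg (by omega), if_neg (by omega)]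
  rfl

theorem Function.End.mul_apply {α : Type*} (f g : Function.End α) (x : α) :
    (f * g) x = f (g x) := rfl

theorem Function.End.pow_apply_add {f : Function.End ℕ} {c : ℕ} (h : ∀ v, f v = v + c) (e v : ℕ) :
    (f ^ e) v = v + e * c := by
  induction e with
  | zero => simp [Function.End.one_def]
  | succ e ih =>
    rw [pow_succ', Function.End.mul_apply, ih, h]
    ring

theorem Function.End.pow_apply_fixed {α : Type*} {f : Function.End α} {x : α} (h : f x = x)
    (e : ℕ) : (f ^ e) x = x := by
  induction e with
  | zero => rfl
  | succ e ih => rw [pow_succ', Function.End.mul_apply, ih, h]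

theorem pairProd_letterMap_apply_of_lt (k : ℕ → ℕ) {j m : ℕ} (hj : j < t)
    (hm : m ≤ j) (v : ℕ) :
    pairProd (letterMap succEnd predEnd s t) j k m v =
      v + ∑ i ∈ Finset.range m, k i * ((if j < s then 1 else 0) + if i < s then 1 else 0) := by
  induction m generalizing v with
  | zero => rfl
  | succ m ih =>
    have hpair (v : ℕ) : (letterMap succEnd predEnd s t j * letterMap succEnd predEnd s t m) v =
        v + ((if j < s then 1 else 0) + if m < s then 1 else 0) := by
      rw [Function.End.mul_apply, letterMap_apply_of_lt (show m < t by omega),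
        letterMap_apply_of_lt hj]
      ring
    rw [pairProd, Function.End.mul_apply,
      Function.End.pow_apply_add hpair, ih (by omega), Finset.sum_range_succ]
    ring

/-- The right letter of a pair acts first and raises `0` to at most `1`; the left one, a truncated
predecessor, brings it back to `0`. -/
theorem pairProd_letterMap_apply_zero (hst : s ≤ t) (k : ℕ → ℕ) {j m : ℕ} (hj : t ≤ j) :
    pairProd (letterMap succEnd predEnd s t) j k m 0 = (0 : ℕ) := by
  induction m with
  | zero => rfl
  | succ m ih =>
    have hpair : (letterMap succEnd predEnd s t j * letterMap succEnd predEnd s t m) 0 =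
        (0 : ℕ) := by
      rw [Function.End.mul_apply, letterMap_apply_of_le hst hj]
      rcases lt_or_ge m t with h | h
      · rw [letterMap_apply_of_lt h]
        split_ifs <;> rfl
      · rw [letterMap_apply_of_le hst h]
    rw [pairProd, Function.End.mul_apply,
      Function.End.pow_apply_fixed hpair, ih]

theorem staircase_letterMap_apply_zero (hst : s ≤ t) (k : ℕ → ℕ → ℕ) {N : ℕ} (hN : t ≤ N) :
    staircase (letterMap succEnd predEnd s t) k N 0 = ∑ j ∈ Finset.range t, rowCount s k j := by
  induction N, hN using Nat.le_induction with
  | base =>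
    have key (m v : ℕ) (hm : m ≤ t) : staircase (letterMap succEnd predEnd s t) k m v =
        v + ∑ j ∈ Finset.range m, rowCount s k j := by
      induction m generalizing v with
      | zero => rfl
      | succ m ih =>
        rw [staircase, Function.End.mul_apply, Function.End.mul_apply, Function.End.pow_apply_add (letterMap_apply_of_lt hm),
          pairProd_letterMap_apply_of_lt _ hm le_rfl, ih _ (by omega),
          Finset.sum_range_succ, rowCount]
        ring
    rw [key t 0 le_rfl, zero_add]
  | succ N hN ih =>
    have hfix : letterMap succEnd predEnd s t N 0 = (0 : ℕ) := letterMap_apply_of_le hst hN 0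
    rw [staircase, Function.End.mul_apply, Function.End.mul_apply, Function.End.pow_apply_fixed hfix, pairProd_letterMap_apply_zero hst _ hN,
      ih]

end Height

theorem map_pairProd {M N : Type*} [Monoid M] [Monoid N] (f : M →* N) (a : ℕ → M) (j : ℕ)
    (k : ℕ → ℕ) (m : ℕ) : f (pairProd a j k m) = pairProd (fun i => f (a i)) j k m := by
  induction m with
  | zero => exact map_one f
  | succ m ih => simp [pairProd, ih]

theorem map_staircase {M N : Type*} [Monoid M] [Monoid N] (f : M →* N) (a : ℕ → M)
    (k : ℕ → ℕ → ℕ) (m : ℕ) : f (staircase a k m) = staircase (fun i => f (a i)) k m := by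
  induction m with
  | zero => exact map_one f
  | succ m ih => simp [staircase, ih, map_pairProd]

theorem pairProd_congr_seq {M : Type*} [Monoid M] {a b : ℕ → M} {j : ℕ} (k : ℕ → ℕ) {m : ℕ}
    (hm : m ≤ j) (h : ∀ i ≤ j, a i = b i) : pairProd a j k m = pairProd b j k m := by
  induction m with
  | zero => rfl
  | succ m ih => rw [pairProd, pairProd, ih (by omega), h j le_rfl, h m (by omega)]

theorem staircase_congr_seq {M : Type*} [Monoid M] {a b : ℕ → M} (k : ℕ → ℕ → ℕ) {N : ℕ}
    (h : ∀ i < N, a i = b i) : staircase a k N = staircase b k N := by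
  induction N with
  | zero => rfl
  | succ N ih =>
    rw [staircase, staircase, ih fun i hi => h i (by omega), h N (by omega),
      pairProd_congr_seq (k N) le_rfl fun i hi => h i (by omega)]

/-! ### Faithful coordinates on the Chinese monoid -/

namespace ChineseMonoid

variable {n : ℕ}

/-- The homomorphism from the Chinese monoid given by a sequence satisfying its relations. -/
def lift {M : Type*} [Monoid M] (a : ℕ → M) (ha : IsChinese n a) : ChineseMonoid n →* M :=
  PresentedMonoid.lift (fun i : Fin n => a i) (by
    rintro _ _ (⟨i, k, j, hik, hkj⟩ | ⟨i, k, j, hik, hkj⟩)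
    · simpa using (ha i k j hik hkj j.2).1
    · simpa using (ha i k j hik hkj j.2).2)

@[simp]
theorem lift_of {M : Type*} [Monoid M] (a : ℕ → M) (ha : IsChinese n a) (i : Fin n) :
    lift a ha (PresentedMonoid.of (ChineseRel n) i) = a i :=
  rfl

/-- The generators of the Chinese monoid of rank `n`, extended by `1` to a sequence. -/
def gen (n i : ℕ) : ChineseMonoid n :=
  if h : i < n then PresentedMonoid.of (ChineseRel n) ⟨i, h⟩ else 1

theorem gen_of_lt {i : ℕ} (h : i < n) : gen n i = PresentedMonoid.of (ChineseRel n) ⟨i, h⟩ :=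
  dif_pos h

theorem lift_gen {M : Type*} [Monoid M] (a : ℕ → M) (ha : IsChinese n a) {i : ℕ} (hi : i < n) :
    lift a ha (gen n i) = a i := by
  rw [gen_of_lt hi, lift_of]

theorem isChinese_gen : IsChinese n (gen n) := by
  intro i k j hik hkj hj
  rw [gen_of_lt hj, gen_of_lt (hkj.trans_lt hj), gen_of_lt ((hik.trans hkj).trans_lt hj)]
  exact ⟨PresentedMonoid.mk_eq_mk_of_rel (.jik_jki ⟨i, _⟩ ⟨k, _⟩ ⟨j, hj⟩ hik hkj),
    PresentedMonoid.mk_eq_mk_of_rel (.jki_kji ⟨i, _⟩ ⟨k, _⟩ ⟨j, hj⟩ hik hkj)⟩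

theorem exists_eq_staircase (w : ChineseMonoid n) : ∃ k, w = staircase (gen n) k n := by
  have hw : w ∈ Submonoid.closure (Set.range (PresentedMonoid.of (ChineseRel n))) := by
    rw [PresentedMonoid.closure_range_of]
    trivial
  induction hw using Submonoid.closure_induction_right with
  | one =>
    refine ⟨0, ?_⟩
    have hp (j m : ℕ) : pairProd (gen n) j 0 m = 1 := by
      induction m with
      | zero => rfl
      | succ m ih => simp [pairProd, ih]
    have hs (m : ℕ) : staircase (gen n) 0 m = 1 := by
      induction m with
      | zero => rfl
      | succ m ih => simp [staircase, ih, hp]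
    exact (hs n).symm
  | mul_right x _ y hy ih =>
    obtain ⟨k, rfl⟩ := ih
    obtain ⟨i, rfl⟩ := hy
    rw [← gen_of_lt i.2]
    exact isChinese_gen.exists_staircase_mul k i.2 le_rfl

/-- The action of the Chinese monoid on `ℕ` in which the letters below `s` act as successor, those
from `t` on as predecessor, and the others trivially. -/
def action (n : ℕ) {s t : ℕ} (hst : s ≤ t) : ChineseMonoid n →* Function.End ℕ :=
  lift _ (isChinese_letterMap predEnd_mul_succEnd hst n)

theorem eq_of_action_eq {w w' : ChineseMonoid n}
    (h : ∀ s t (hst : s ≤ t), 1 ≤ s → t ≤ n → action n hst w = action n hst w') : w = w' := by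
  obtain ⟨k, rfl⟩ := exists_eq_staircase w
  obtain ⟨k', rfl⟩ := exists_eq_staircase w'
  refine staircase_congr _ (eq_of_sum_rowCount_eq fun s t hs hst ht => ?_)
  have key (κ : ℕ → ℕ → ℕ) : action n hst (staircase (gen n) κ n) 0 =
      ∑ j ∈ Finset.range t, rowCount s κ j := by
    rw [map_staircase, staircase_congr_seq κ (a := fun i => action n hst (gen n i))
      (b := letterMap succEnd predEnd s t) fun i hi => lift_gen _ _ hi]
    exact staircase_letterMap_apply_zero hst κ ht
  rw [← key, ← key, h s t hst hs ht]

theorem bicyclic_q_mul_p : PresentedMonoid.of BicyclicRel .q * PresentedMonoid.of BicyclicRel .p =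
    1 :=
  PresentedMonoid.mk_eq_mk_of_rel .qp_one

/-- The homomorphism to the bicyclic monoid that sends the letters below `s` to `p`, those from `t`
on to `q`, and the others to `1`. -/
def toBicyclic (n : ℕ) {s t : ℕ} (hst : s ≤ t) : ChineseMonoid n →* BicyclicMonoid :=
  lift _ (isChinese_letterMap bicyclic_q_mul_p hst n)

/-- The homomorphism from the bicyclic monoid given by elements with `q * p = 1`. -/
def bicyclicLift {M : Type*} [Monoid M] (p q : M) (h : q * p = 1) : BicyclicMonoid →* M :=
  PresentedMonoid.lift (fun | .p => p | .q => q) (by rintro _ _ ⟨⟩; simpa using h)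

theorem bicyclicLift_comp_toBicyclic {M : Type*} [Monoid M] (p q : M) (h : q * p = 1) {s t : ℕ}
    (hst : s ≤ t) : (bicyclicLift p q h).comp (toBicyclic n hst) =
      lift _ (isChinese_letterMap h hst n) := by
  refine PresentedMonoid.ext _ fun i => ?_
  simp only [MonoidHom.comp_apply, toBicyclic, lift_of, map_letterMap]
  rfl

theorem action_eq_of_toBicyclic_eq {s t : ℕ} (hst : s ≤ t) {w w' : ChineseMonoid n}
    (h : toBicyclic n hst w = toBicyclic n hst w') : action n hst w = action n hst w' := by
  rw [action, ← bicyclicLift_comp_toBicyclic _ _ predEnd_mul_succEnd, MonoidHom.comp_apply, h,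
    MonoidHom.comp_apply]

theorem isChinese_of_comm {M : Type*} [CommMonoid M] (a : ℕ → M) : IsChinese n a :=
  fun i k j _ _ _ => ⟨mul_right_comm _ _ _, by rw [mul_comm (a j)]⟩

/-- The number of letters below `s`. -/
def count (n s : ℕ) : ChineseMonoid n →* Multiplicative ℕ :=
  lift (fun i => Multiplicative.ofAdd (if i < s then 1 else 0)) (isChinese_of_comm _)

/-- With `t = n` no letter acts as predecessor, so only powers of successor occur. -/
theorem action_eq_of_count_eq {s : ℕ} (hs : s ≤ n) {w w' : ChineseMonoid n}
    (h : count n s w = count n s w') : action n hs w = action n hs w' := by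
  let shift : Multiplicative ℕ →* Function.End ℕ := powersHom _ succEnd
  have hcomp : action n hs = shift.comp (count n s) := by
    refine PresentedMonoid.ext _ fun i => ?_
    simp only [MonoidHom.comp_apply, action, count, lift_of, shift, powersHom_apply, letterMap, i.2]
    split_ifs <;> simp
  rw [hcomp, MonoidHom.comp_apply, h, MonoidHom.comp_apply]

theorem eq_of_toBicyclic_eq_of_count_eq {w w' : ChineseMonoid n}
    (hB : ∀ s t (hst : s ≤ t), 1 ≤ s → t < n → toBicyclic n hst w = toBicyclic n hst w')
    (hN : ∀ s, 1 ≤ s → s ≤ n → count n s w = count n s w') : w = w' := by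
  refine eq_of_action_eq fun s t hst hs ht => ?_
  rcases ht.lt_or_eq with ht | rfl
  · exact action_eq_of_toBicyclic_eq hst (hB s t hst hs ht)
  · exact action_eq_of_count_eq hst (hN s hs hst)

/-- In rank two, one bicyclic and one commutative coordinate are faithful. -/
theorem eq_of_toBicyclic_eq_of_count_eq_two {w w' : ChineseMonoid 2}
    (hB : toBicyclic 2 (le_refl 1) w = toBicyclic 2 (le_refl 1) w')
    (hN : count 2 1 w = count 2 1 w') : w = w' := by
  have hcount : count 2 2 w = count 2 2 w' := by
    let toInt : Multiplicative ℕ →* Multiplicative ℤ :=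
      AddMonoidHom.toMultiplicative (Nat.castAddMonoidHom ℤ)
    let net : BicyclicMonoid →* Multiplicative ℤ :=
      bicyclicLift (Multiplicative.ofAdd 1) (Multiplicative.ofAdd (-1)) (by rw [← ofAdd_add]; rfl)
    -- With `x` and `y` occurrences of the two letters, this is `(x - y) + (x + y) = 2 * x`, which
    -- recovers the length.
    have key : (net.comp (toBicyclic 2 (le_refl 1))) * (toInt.comp (count 2 2)) =
        (toInt.comp (count 2 1)) ^ 2 := by
      refine PresentedMonoid.ext _ fun i => ?_
      simp only [net, bicyclicLift_comp_toBicyclic, MonoidHom.mul_apply, MonoidHom.comp_apply,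
        MonoidHom.pow_apply, count, lift_of, toInt]
      fin_cases i <;> rfl
    have h1 := DFunLike.congr_fun key w
    have h2 := DFunLike.congr_fun key w'
    simp only [MonoidHom.mul_apply, MonoidHom.comp_apply, MonoidHom.pow_apply] at h1 h2
    rw [hB, hN, ← h2] at h1
    have h3 : ((count 2 2 w).toAdd : ℤ) = (count 2 2 w').toAdd :=
      congrArg Multiplicative.toAdd (mul_left_cancel h1)
    exact_mod_cast h3
  refine eq_of_toBicyclic_eq_of_count_eq (fun s t hst hs ht => ?_) fun s hs hs' => ?_
  · obtain rfl : s = 1 := by omega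
    obtain rfl : t = 1 := by omega
    exact hB
  · obtain rfl | rfl : s = 1 ∨ s = 2 := by omega
    · exact hN
    · exact hcount

end ChineseMonoid

/-! ### Matching the number of coordinates -/

theorem tribonacci_pos (m : ℕ) : 1 ≤ tribonacci m := by
  induction m using tribonacci.induct <;> simp [tribonacci]; omega

theorem le_tribonacci_add_three (m : ℕ) : m + 3 ≤ tribonacci (m + 3) := by
  induction m with
  | zero => decide
  | succ m ih =>
    change m + 1 + 3 ≤ tribonacci (m + 3) + tribonacci (m + 2) + tribonacci (m + 1)
    have := tribonacci_pos (m + 2)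
    omega

open ChineseMonoid in
theorem exists_injective_of_le {n : ℕ} (hn : n ≤ tribonacci n) :
    ∃ c d : ℕ, c + 2 * d = n * tribonacci n ∧
      ∃ f : ChineseMonoid n →*
          (Fin c → Multiplicative ℕ) × (Fin d → BicyclicMonoid × Multiplicative ℤ),
        Function.Injective f := by
  let ι := Σ t : Fin (n - 1), Fin (t + 1)
  have hcard : 2 * Fintype.card ι = n * (n - 1) := by
    rw [Fintype.card_sigma]
    simp only [Fintype.card_fin]
    rw [Fin.sum_univ_eq_sum_range (fun t => t + 1)]
    rcases n with _ | m
    · simp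
    · have := Finset.sum_range_succ' (fun i => i) m
      rw [add_tsub_cancel_right, ← add_zero (∑ t ∈ Finset.range m, (t + 1)), ← this, mul_comm,
        Finset.sum_range_id_mul_two, add_tsub_cancel_right]
  have hle : n + n * (n - 1) ≤ n * tribonacci n := by
    calc n + n * (n - 1) = n * n := by
          rcases n with _ | m
          · rfl
          · rw [add_tsub_cancel_right]; ring
      _ ≤ _ := Nat.mul_le_mul_left n hn
  let e := Fintype.equivFin ι
  -- There are at least `n` coordinates here by `hle`; those beyond the first `n` are padding, as
  -- are the trivial `ℤ` coordinates of `G`.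
  let F : ChineseMonoid n →* (Fin (n * tribonacci n - n * (n - 1)) → Multiplicative ℕ) :=
    MonoidHom.pi fun s => count n (s + 1)
  let G : ChineseMonoid n →* (Fin (Fintype.card ι) → BicyclicMonoid × Multiplicative ℤ) :=
    MonoidHom.pi fun r => (toBicyclic n (Nat.succ_le_of_lt (e.symm r).2.2)).prod 1
  refine ⟨_, Fintype.card ι, by rw [hcard]; exact Nat.sub_add_cancel (by omega), F.prod G, ?_⟩
  intro w w' h
  have hF : F w = F w' := congrArg Prod.fst h
  have hG : G w = G w' := congrArg Prod.snd h
  refine eq_of_toBicyclic_eq_of_count_eq (fun s t hst hs ht => ?_) fun s hs hs' => ?_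
  · obtain ⟨s, rfl⟩ := Nat.exists_eq_add_of_le' hs
    obtain ⟨t, rfl⟩ := Nat.exists_eq_add_of_le' (hs.trans hst)
    let x : ι := ⟨⟨t, by omega⟩, ⟨s, by simpa using hst⟩⟩
    have hx : ∀ y : ι, y = x → toBicyclic n (Nat.succ_le_of_lt y.2.2) w =
        toBicyclic n (Nat.succ_le_of_lt y.2.2) w' → toBicyclic n hst w = toBicyclic n hst w' := by
      rintro _ rfl hy
      exact hy
    exact hx (e.symm (e x)) (e.symm_apply_apply x) (congrArg Prod.fst (congrFun hG (e x)))
  · obtain ⟨s, rfl⟩ := Nat.exists_eq_add_of_le' hs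
    exact congrFun hF ⟨s, by omega⟩

open ChineseMonoid in
theorem exists_injective_rank_two :
    ∃ f : ChineseMonoid 2 →*
        (Fin 0 → Multiplicative ℕ) × (Fin 1 → BicyclicMonoid × Multiplicative ℤ),
      Function.Injective f := by
  let toInt : Multiplicative ℕ →* Multiplicative ℤ :=
    AddMonoidHom.toMultiplicative (Nat.castAddMonoidHom ℤ)
  refine ⟨MonoidHom.prod 1 (MonoidHom.pi fun _ =>
    (toBicyclic 2 (le_refl 1)).prod (toInt.comp (count 2 1))), fun w w' h => ?_⟩
  have h0 := congrFun (congrArg Prod.snd h) 0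
  refine eq_of_toBicyclic_eq_of_count_eq_two (congrArg Prod.fst h0) ?_
  have h1 : ((count 2 1 w).toAdd : ℤ) = (count 2 1 w').toAdd := congrArg Prod.snd h0
  exact_mod_cast h1

theorem corollary3p3p3 (n : ℕ) (hn : 1 ≤ n) :
    ∃ c d : ℕ, c + 2 * d = n * tribonacci n ∧
      ∃ f : ChineseMonoid n →*
          (Fin c → Multiplicative ℕ) × (Fin d → BicyclicMonoid × Multiplicative ℤ),
        Function.Injective f := by
  match n, hn with
  | 1, _ => exact exists_injective_of_le le_rfl
  | 2, _ => exact ⟨0, 1, rfl, exists_injective_rank_two⟩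
  | m + 3, _ => exact exists_injective_of_le (le_tribonacci_add_three m)
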